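/- Let $G$ be a finite simple connected bipartite graph whose two parts $X$ and $Y$ satisfy $|X| = |Y| = n$ (so $G$ is balanced of order $2n$), where $n \ge 4$, and suppose that every vertex of $G$ has degree at least $2$. Let $\lambda_1$ be the largest eigenvalue of the adjacency matrix of $G$. If $$\lambda_1 \ge \sqrt{n^2 - 2n + 4},$$ then $G$ is bipancyclic, that is, for every even integer $k$ with $4 \le k \le 2n$, the graph $G$ contains a cycle of length $k$. -/

import Mathlib

namespace SimpleGraph

/-- `G` is a balanced bipartite graph with parts `X` and `Y`: the two parts are disjoint, they
cover all the vertices, every edge joins a vertex of `X` to a vertex of `Y`, and the parts have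
the same number of vertices. -/
structure IsBalancedBipartiteWith {V : Type*} [Fintype V] [DecidableEq V]
    (G : SimpleGraph V) (X Y : Finset V) : Prop where
  isBipartiteWith : G.IsBipartiteWith (X : Set V) (Y : Set V)
  union_eq_univ : X ∪ Y = Finset.univ
  card_eq : X.card = Y.card

/-- `G` contains a cycle of length `k`. -/
def HasCycleOfLength {V : Type*} (G : SimpleGraph V) (k : ℕ) : Prop :=
  ∃ (v : V) (p : G.Walk v v), p.IsCycle ∧ p.length = k

/-- `G` contains cycles of every even length from `4` to its number of vertices. -/
def IsBipancyclic {V : Type*} [Fintype V] (G : SimpleGraph V) : Prop :=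
  ∀ k : ℕ, Even k → 4 ≤ k → k ≤ Fintype.card V → G.HasCycleOfLength k

theorem isHermitian_adjMatrix_real {V : Type*} (G : SimpleGraph V) [DecidableRel G.Adj] :
    (G.adjMatrix ℝ).IsHermitian := by
  rw [Matrix.IsHermitian, Matrix.conjTranspose_eq_transpose_of_trivial]
  exact G.isSymm_adjMatrix

/-- The eigenvalues of `G`, with multiplicity and in decreasing order: the eigenvalues of its
adjacency matrix. -/
noncomputable def adjEigenvalues {V : Type*} [Fintype V] [DecidableEq V]
    (G : SimpleGraph V) [DecidableRel G.Adj] : Fin (Fintype.card V) → ℝ :=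
  G.isHermitian_adjMatrix_real.eigenvalues₀

/-- The largest eigenvalue of the adjacency matrix of `G`. -/
noncomputable def maxAdjEigenvalue {V : Type*} [Fintype V] [DecidableEq V] [Nonempty V]
    (G : SimpleGraph V) [DecidableRel G.Adj] : ℝ :=
  G.adjEigenvalues ⟨0, Fintype.card_pos⟩

end SimpleGraph

/-! In a bipartite graph with e edges, λ₁² ≤ e, with equality only for complete bipartite graphs
once isolated vertices are excluded. Hence either G is complete, or e > n² - 2n + 4. With m = n - 2,
at most 2m - 1 cross pairs are then missing, and by the degree hypothesis each vertex misses at most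
m: this is `IsNearlyComplete`.

Such a relation has a spanning cycle. While it is incomplete, counting gives a missing pair of
degree sum at least n + 1 (`IsNearlyComplete.exists_pair`), and adding that pair creates no new
Hamiltonicity (`HasAlternatingCycle.of_closure`); so the question reduces to the complete relation.
Shorter cycles come from deleting one element on each side, chosen to miss as many pairs as
possible, which preserves near completeness (`IsNearlyComplete.exists_erase`). -/

/-! ### Alternating cycles and the bipartite closure. -/

section AlternatingCycle

variable {α β : Type*}

/-- The relation `R` contains a cycle `a 0, b 0, a 1, b 1, …` through `m + 2` elements of `A` and
`m + 2` elements of `B`. -/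
def HasAlternatingCycle (R : α → β → Prop) (A : Finset α) (B : Finset β) (m : ℕ) : Prop :=
  ∃ (a : Fin (m + 2) → α) (b : Fin (m + 2) → β), Function.Injective a ∧ Function.Injective b ∧
    (∀ i, a i ∈ A) ∧ (∀ i, b i ∈ B) ∧ (∀ i, R (a i) (b i)) ∧ ∀ i, R (a (i + 1)) (b i)

theorem HasAlternatingCycle.mono {R : α → β → Prop} {A A' : Finset α} {B B' : Finset β} {m : ℕ}
    (h : HasAlternatingCycle R A B m) (hA : A ⊆ A') (hB : B ⊆ B') :
    HasAlternatingCycle R A' B' m := by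
  obtain ⟨a, b, ha, hb, haA, hbB, h₁, h₂⟩ := h
  exact ⟨a, b, ha, hb, fun i => hA (haA i), fun i => hB (hbB i), h₁, h₂⟩

theorem Fin.val_sub_of_lt {n : ℕ} {i j : Fin n} (h : i < j) :
    ((i - j : Fin n) : ℕ) = n + i - j := by
  rw [Fin.sub_def]
  have := j.2
  have h' : (i : ℕ) < j := h
  simp only
  rw [Nat.mod_eq_of_lt (by omega)]
  omega

/-- Closing up a spanning alternating path `a 0, b 0, …, a (-1), b (-1)` with the two chords
`a 0, b c` and `a c, b (-1)`. -/
theorem HasAlternatingCycle.of_crossing {R : α → β → Prop} {A : Finset α} {B : Finset β} {m : ℕ}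
    {a : Fin (m + 2) → α} {b : Fin (m + 2) → β} (ha : Function.Injective a)
    (hb : Function.Injective b) (haA : ∀ i, a i ∈ A) (hbB : ∀ i, b i ∈ B)
    (h₁ : ∀ i, R (a i) (b i)) (h₂ : ∀ i, i ≠ Fin.last _ → R (a (i + 1)) (b i))
    (c : Fin (m + 2)) (hc : R (a 0) (b c)) (hc' : R (a c) (b (Fin.last _))) :
    HasAlternatingCycle R A B m := by
  have hlast : (Fin.last (m + 1)) + 1 = 0 := Fin.last_add_one _
  have hsucc : ∀ i : Fin (m + 2), i ≠ Fin.last _ → ((i + 1 : Fin (m + 2)) : ℕ) = i + 1 := by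
    intro i hi
    exact Fin.val_add_one_of_lt (Fin.lt_last_iff_ne_last.2 hi)
  -- The new cycle runs forward `a 0, b 0, …, a c`, jumps to `b (-1)`, then runs backward `a (-1),
  -- …, a (c + 1), b c` and returns to `a 0`. Indices are mod `m + 2`, so `c - j` enumerates the
  -- backward stretch from the last index.
  let p : Fin (m + 2) → Fin (m + 2) := fun j => if j ≤ c then j else c - j
  let q : Fin (m + 2) → Fin (m + 2) := fun j => if j < c then j else c - (j + 1)
  have hpv : ∀ j, ((p j : Fin (m + 2)) : ℕ) = if (j : ℕ) ≤ c then (j : ℕ) else m + 2 + c - j := by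
    intro j
    by_cases h : j ≤ c
    · simp [p, h]
    · have h' : ¬ (j : ℕ) ≤ c := h
      simp only [p, h, h', if_false]
      exact Fin.val_sub_of_lt (not_le.1 h)
  have hqv : ∀ j, ((q j : Fin (m + 2)) : ℕ) = if (j : ℕ) < c then (j : ℕ) else m + 1 + c - j := by
    intro j
    by_cases h : j < c
    · simp [q, h]
    · have h' : ¬ (j : ℕ) < c := h
      simp only [q, h, h', if_false]
      by_cases hj : j = Fin.last _
      · subst hj
        rw [hlast, sub_zero]
        simp
      · have h1 := hsucc j hj
        rw [Fin.val_sub_of_lt (by rw [Fin.lt_def, h1]; omega), h1]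
        omega
  have hp : Function.Injective p := by
    intro i j hij
    have h := congrArg Fin.val hij
    rw [hpv, hpv] at h
    have := i.2
    have := j.2
    ext
    split_ifs at h <;> omega
  have hq : Function.Injective q := by
    intro i j hij
    have h := congrArg Fin.val hij
    rw [hqv, hqv] at h
    have := i.2
    have := j.2
    ext
    split_ifs at h <;> omega
  refine ⟨a ∘ p, b ∘ q, ha.comp hp, hb.comp hq, fun i => haA _, fun i => hbB _, ?_, ?_⟩
  · intro j
    rcases lt_trichotomy j c with h | h | h
    · simpa [p, q, h, h.le] using h₁ j
    · subst h
      have hq' : q j = Fin.last _ := by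
        ext
        rw [hqv]
        simp
      have hp' : p j = j := by simp [p]
      simpa [hp', hq'] using hc'
    · have h3 : p j = q j + 1 := by
        simp only [p, q, not_le.2 h, not_lt.2 h.le, if_false]
        abel
      have h4 : q j ≠ Fin.last _ := by
        intro h4
        have := congrArg Fin.val h4
        rw [hqv] at this
        have h' : (c : ℕ) < j := h
        simp at this
        split_ifs at this <;> omega
      simpa [h3] using h₂ _ h4
  · intro j
    by_cases hj : j = Fin.last _
    · subst hj
      have h5 : q (Fin.last _) = c := by
        ext
        rw [hqv]
        have := c.2
        simp
        intro; omega
      have h6 : p 0 = 0 := by simp [p]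
      simpa [hlast, h5, h6] using hc
    · have h7 := hsucc j hj
      by_cases h : j < c
      · have h' : (j : ℕ) < c := h
        have h8 : j + 1 ≤ c := by rw [Fin.le_def, h7]; omega
        simpa [p, q, h, h8] using h₂ j hj
      · have h' : ¬ (j : ℕ) < c := h
        have h8 : ¬ (j + 1 ≤ c) := by rw [Fin.le_def, h7]; omega
        simpa [p, q, h, h8] using h₁ (c - (j + 1))

open Classical in
/-- The bipartite Bondy–Chvátal closure step. -/
theorem HasAlternatingCycle.of_closure {R : α → β → Prop} {A : Finset α} {B : Finset β} {m : ℕ}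
    (hA : A.card = m + 2) (hB : B.card = m + 2) {x : α} {y : β}
    (hdeg : m + 3 ≤ (B.filter (fun y' => R x y')).card + (A.filter (fun x' => R x' y)).card)
    (h : HasAlternatingCycle (fun x' y' => R x' y' ∨ (x' = x ∧ y' = y)) A B m) :
    HasAlternatingCycle R A B m := by
  have key : ∀ (a : Fin (m + 2) → α) (b : Fin (m + 2) → β), Function.Injective a →
      Function.Injective b → (∀ i, a i ∈ A) → (∀ i, b i ∈ B) →
      (∀ i, R (a i) (b i) ∨ (a i = x ∧ b i = y)) →
      (∀ i, R (a (i + 1)) (b i) ∨ (a (i + 1) = x ∧ b i = y)) →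
      (∃ i, a (i + 1) = x ∧ b i = y) → HasAlternatingCycle R A B m := by
    rintro a b ha hb haA hbB h₁ h₂ ⟨i, hax, hby⟩
    have ha' : Function.Injective (fun j => a (j + (i + 1))) := fun j k hjk =>
      add_right_cancel (ha hjk)
    have hb' : Function.Injective (fun j => b (j + (i + 1))) := fun j k hjk =>
      add_right_cancel (hb hjk)
    have hlast : (Fin.last (m + 1)) + 1 = 0 := Fin.last_add_one _
    have hlasti : Fin.last (m + 1) + (i + 1) = i := by
      rw [add_comm i 1, ← add_assoc, hlast, zero_add]
    have hBim : B = Finset.univ.image (fun j => b (j + (i + 1))) := by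
      symm
      apply Finset.eq_of_subset_of_card_le
      · intro z hz
        obtain ⟨j, -, rfl⟩ := Finset.mem_image.1 hz
        exact hbB _
      · rw [Finset.card_image_of_injective _ hb', hB]; simp
    have hAim : A = Finset.univ.image (fun j => a (j + (i + 1))) := by
      symm
      apply Finset.eq_of_subset_of_card_le
      · intro z hz
        obtain ⟨j, -, rfl⟩ := Finset.mem_image.1 hz
        exact haA _
      · rw [Finset.card_image_of_injective _ ha', hA]; simp
    -- After rotation the added pair is the closing edge of a spanning path from `x` to `y`. The
    -- positions of neighbours of `x` and of `y` total at least `m + 3` among `m + 2` indices, so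
    -- some index carries both.
    obtain ⟨c, hc⟩ : ∃ c, R x (b (c + (i + 1))) ∧ R (a (c + (i + 1))) y := by
      by_contra hne
      push Not at hne
      rw [hAim, hBim, Finset.filter_image, Finset.filter_image,
        Finset.card_image_of_injective _ hb', Finset.card_image_of_injective _ ha',
        ← Finset.card_union_of_disjoint] at hdeg
      · have := hdeg.trans (Finset.card_le_univ _)
        simp at this
      · rw [Finset.disjoint_left]
        intro j hj hj'
        simp only [Finset.mem_filter, Finset.mem_univ, true_and] at hj hj'
        exact hne j hj hj'
    refine HasAlternatingCycle.of_crossing ha' hb' (fun j => haA _) (fun j => hbB _) ?_ ?_ c ?_ ?_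
    · intro j
      rcases h₁ (j + (i + 1)) with h | ⟨h, h'⟩
      · exact h
      · exfalso
        have e1 := ha (h.trans hax.symm)
        have e2 := hb (h'.trans hby.symm)
        have : i + 1 = i := e1.symm.trans e2
        simp at this
    · intro j hj
      have e : j + 1 + (i + 1) = (j + (i + 1)) + 1 := by abel
      simp only [e]
      rcases h₂ (j + (i + 1)) with h | ⟨h, h'⟩
      · exact h
      · exfalso
        apply hj
        have e3 : j + (i + 1) = Fin.last _ + (i + 1) := by
          rw [hlasti]; exact hb (h'.trans hby.symm)
        exact add_right_cancel e3
    · simpa [hax] using hc.1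
    · simp only [hlasti, hby]; exact hc.2
  obtain ⟨a, b, ha, hb, haA, hbB, h₁, h₂⟩ := h
  by_cases h3 : ∃ i, a (i + 1) = x ∧ b i = y
  · exact key a b ha hb haA hbB h₁ h₂ h3
  by_cases h4 : ∃ i, a i = x ∧ b i = y
  -- Reversing the orientation swaps the two kinds of edges, reducing to `key`.
  · refine key (fun j => a (-j)) (fun j => b (-(j + 1))) (fun j k hjk => neg_injective (ha hjk))
      (fun j k hjk => add_right_cancel (neg_injective (hb hjk))) (fun i => haA _)
      (fun i => hbB _) ?_ ?_ ?_
    · intro j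
      have e : -j = -(j + 1) + 1 := by abel
      have := h₂ (-(j + 1))
      rwa [← e] at this
    · intro j
      exact h₁ (-(j + 1))
    · obtain ⟨i, hi⟩ := h4
      refine ⟨-i - 1, ?_⟩
      simpa using hi
  push Not at h3 h4
  exact ⟨a, b, ha, hb, haA, hbB, fun i => (h₁ i).resolve_right fun h => h4 i h.1 h.2,
    fun i => (h₂ i).resolve_right fun h => h3 i h.1 h.2⟩

/-! ### Nearly complete relations. -/

open Classical in
/-- A nearly complete balanced bipartite relation: parts of size `m + 2`, at most `2 * m - 1`
non-related pairs, and every element related to at least two elements of the other part. -/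
structure IsNearlyComplete (R : α → β → Prop) (A : Finset α) (B : Finset β) (m : ℕ) : Prop where
  card_left : A.card = m + 2
  card_right : B.card = m + 2
  sum_le : ∑ x ∈ A, (B.filter fun y => ¬ R x y).card ≤ 2 * m - 1
  left_le : ∀ x ∈ A, (B.filter fun y => ¬ R x y).card ≤ m
  right_le : ∀ y ∈ B, (A.filter fun x => ¬ R x y).card ≤ m

open Classical in
theorem sum_card_filter_not_comm (R : α → β → Prop) (A : Finset α) (B : Finset β) :
    ∑ x ∈ A, (B.filter fun y => ¬ R x y).card = ∑ y ∈ B, (A.filter fun x => ¬ R x y).card :=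
  Finset.sum_card_bipartiteAbove_eq_sum_card_bipartiteBelow (fun x y => ¬ R x y)

theorem HasAlternatingCycle.of_complete {R : α → β → Prop} {A : Finset α} {B : Finset β} {m : ℕ}
    (hA : A.card = m + 2) (hB : B.card = m + 2) (h : ∀ x ∈ A, ∀ y ∈ B, R x y) :
    HasAlternatingCycle R A B m := by
  let e := (A.equivFinOfCardEq hA).symm
  let f := (B.equivFinOfCardEq hB).symm
  exact ⟨fun i => e i, fun i => f i, Subtype.val_injective.comp e.injective,
    Subtype.val_injective.comp f.injective, fun i => (e i).2, fun i => (f i).2,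
    fun i => h _ (e i).2 _ (f i).2, fun i => h _ (e _).2 _ (f i).2⟩

open Classical in
/-- A nearly complete relation which is not complete has a non-related pair of large degree sum. -/
theorem IsNearlyComplete.exists_pair {R : α → β → Prop} {A : Finset α} {B : Finset β} {m : ℕ}
    (h : IsNearlyComplete R A B m) (hne : ∃ x ∈ A, ∃ y ∈ B, ¬ R x y) :
    ∃ x ∈ A, ∃ y ∈ B, ¬ R x y ∧
      (B.filter fun y' => ¬ R x y').card + (A.filter fun x' => ¬ R x' y).card ≤ m + 1 := by
  by_contra! hcon
  obtain ⟨x, hx, y, hy, hxy⟩ := hne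
  set p := (B.filter fun y' => ¬ R x y').card with hp
  -- Each of the `p` elements missed by `x` itself misses at least `m + 2 - p`, by the contrary
  -- assumption.
  have h1 : p * (m + 2 - p) ≤ ∑ y' ∈ B, (A.filter fun x' => ¬ R x' y').card := by
    calc p * (m + 2 - p) = ∑ y' ∈ B.filter (fun y' => ¬ R x y'), (m + 2 - p) := by
          rw [Finset.sum_const, smul_eq_mul]
      _ ≤ ∑ y' ∈ B.filter (fun y' => ¬ R x y'), (A.filter fun x' => ¬ R x' y').card := by
          apply Finset.sum_le_sum
          intro y' hy'
          rw [Finset.mem_filter] at hy'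
          have := hcon x hx y' hy'.1 hy'.2
          omega
      _ ≤ _ := Finset.sum_le_sum_of_subset (Finset.filter_subset _ _)
  have h2 := h.sum_le
  rw [sum_card_filter_not_comm] at h2
  have h3 := h.left_le x hx
  have h4 := h.right_le y hy
  have h5 := hcon x hx y hy hxy
  rw [← hp] at h3 h5
  obtain ⟨s, hs⟩ := Nat.exists_eq_add_of_le (show 2 ≤ p by omega)
  obtain ⟨t, ht⟩ := Nat.exists_eq_add_of_le h3
  have h6 : p * (m + 2 - p) ≤ 2 * m - 1 := h1.trans h2
  have h7 : m + 2 - p = t + 2 := by omega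
  rw [h7, hs] at h6
  -- For `2 ≤ p ≤ m` this is `p (m + 2 - p) = 2m + (p - 2)(m - p) ≥ 2m`, too many missing pairs.
  have h8 : (2 + s) * (t + 2) = 2 * m + s * t := by rw [ht, hs]; ring
  rw [h8] at h6
  omega

open Classical in
/-- A nearly complete relation has a spanning alternating cycle. -/
theorem IsNearlyComplete.hasAlternatingCycle {R : α → β → Prop} {A : Finset α} {B : Finset β}
    {m : ℕ} (h : IsNearlyComplete R A B m) : HasAlternatingCycle R A B m := by
  -- Induction on the number of missing pairs, `A` and `B` being fixed and `R` growing.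
  induction hM : ∑ x ∈ A, (B.filter fun y => ¬ R x y).card using Nat.strong_induction_on
    generalizing R with
  | _ M ih =>
  by_cases hne : ∃ x ∈ A, ∃ y ∈ B, ¬ R x y
  · obtain ⟨x, hx, y, hy, hxy, hle⟩ := h.exists_pair hne
    obtain ⟨R', hR'⟩ : ∃ R' : α → β → Prop,
        R' = fun x' y' => R x' y' ∨ (x' = x ∧ y' = y) := ⟨_, rfl⟩
    have hRR' : ∀ x' y', R x' y' → R' x' y' := fun x' y' h => by rw [hR']; exact Or.inl h
    have hsub : ∀ x', (B.filter fun y' => ¬ R' x' y') ⊆ B.filter fun y' => ¬ R x' y' := fun x' =>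
      Finset.monotone_filter_right _ fun y' _ hy' hR => hy' (hRR' _ _ hR)
    have hsub' : ∀ y', (A.filter fun x' => ¬ R' x' y') ⊆ A.filter fun x' => ¬ R x' y' := fun y' =>
      Finset.monotone_filter_right _ fun x' _ hx' hR => hx' (hRR' _ _ hR)
    have hlt : ∑ x ∈ A, (B.filter fun y => ¬ R' x y).card < M := by
      rw [← hM]
      refine Finset.sum_lt_sum (fun x' _ => Finset.card_le_card (hsub x')) ⟨x, hx, ?_⟩
      refine Finset.card_lt_card (Finset.ssubset_iff_of_subset (hsub x) |>.2 ⟨y, ?_, ?_⟩)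
      · simp [hy, hxy]
      · simp [hR']
    have hcycle : HasAlternatingCycle R' A B m :=
      ih _ hlt ⟨h.card_left, h.card_right, by have := h.sum_le; omega,
        fun x' hx' => (Finset.card_le_card (hsub x')).trans (h.left_le x' hx'),
        fun y' hy' => (Finset.card_le_card (hsub' y')).trans (h.right_le y' hy')⟩ rfl
    rw [hR'] at hcycle
    refine HasAlternatingCycle.of_closure h.card_left h.card_right ?_ hcycle
    have e1 := Finset.card_filter_add_card_filter_not (s := B) (fun y' => R x y')
    have e2 := Finset.card_filter_add_card_filter_not (s := A) (fun x' => R x' y)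
    have := h.card_left
    have := h.card_right
    omega
  · push Not at hne
    exact HasAlternatingCycle.of_complete h.card_left h.card_right hne

open Classical in
/-- Deleting a suitable pair of elements keeps a relation nearly complete. -/
theorem IsNearlyComplete.exists_erase {R : α → β → Prop} {A : Finset α} {B : Finset β} {m : ℕ}
    (h : IsNearlyComplete R A B (m + 1)) :
    ∃ A' ⊆ A, ∃ B' ⊆ B, IsNearlyComplete R A' B' m := by
  obtain ⟨x, hx, hxmax⟩ := A.exists_max_image (fun x => (B.filter fun y => ¬ R x y).card)
    (Finset.card_pos.1 (by rw [h.card_left]; omega))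
  -- Maximality of `y` is measured after deleting `x`, so the missing pairs removed with `x` and
  -- with `y` are counted disjointly.
  obtain ⟨y, hy, hymax⟩ := B.exists_max_image
    (fun y => ((A.erase x).filter fun x' => ¬ R x' y).card)
    (Finset.card_pos.1 (by rw [h.card_right]; omega))
  have s1 := Finset.add_sum_erase A (fun x => (B.filter fun y => ¬ R x y).card) hx
  have s2 := Finset.add_sum_erase B (fun y => ((A.erase x).filter fun x' => ¬ R x' y).card) hy
  rw [← sum_card_filter_not_comm R (A.erase x) B] at s2
  have hsum := h.sum_le
  have hmono : ∀ x', ((B.erase y).filter fun y' => ¬ R x' y').card ≤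
      (B.filter fun y' => ¬ R x' y').card := fun x' =>
    Finset.card_le_card (Finset.filter_subset_filter _ (Finset.erase_subset _ _))
  refine ⟨A.erase x, Finset.erase_subset _ _, B.erase y, Finset.erase_subset _ _, ?_, ?_, ?_, ?_,
    ?_⟩
  · rw [Finset.card_erase_of_mem hx, h.card_left]; omega
  · rw [Finset.card_erase_of_mem hy, h.card_right]; omega
  · rw [sum_card_filter_not_comm]
    -- If a missing pair survives, `x` and `y` each removed at least one, so the bound drops by the
    -- required 2. The zero case is separate because `2 * m - 1` truncates to 0 at `m = 0`.
    rcases Nat.eq_zero_or_pos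
      (∑ y' ∈ B.erase y, ((A.erase x).filter fun x' => ¬ R x' y').card) with h0 | h0
    · omega
    · obtain ⟨y', hy', hpos⟩ := Finset.sum_pos_iff.1 h0
      have h1 := hymax y' (Finset.mem_of_mem_erase hy')
      obtain ⟨x', hx'⟩ := Finset.card_pos.1 hpos
      rw [Finset.mem_filter] at hx'
      have h2 := hxmax x' (Finset.mem_of_mem_erase hx'.1)
      have h3 : 0 < (B.filter fun y => ¬ R x' y).card :=
        Finset.card_pos.2 ⟨y', by simp [Finset.mem_of_mem_erase hy', hx'.2]⟩
      omega
  · intro x' hx'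
    -- `x'` misses no more than `x`, so twice its count is at most the total `2m + 1`. The same
    -- argument with `y` handles the other side.
    have h1 := hxmax x' (Finset.mem_of_mem_erase hx')
    have h2 := hmono x'
    have h3 := Finset.single_le_sum (f := fun x => (B.filter fun y => ¬ R x y).card)
      (fun _ _ => Nat.zero_le _) hx'
    omega
  · intro y' hy'
    have h1 := hymax y' (Finset.mem_of_mem_erase hy')
    have h3 := Finset.single_le_sum (f := fun y => ((A.erase x).filter fun x' => ¬ R x' y).card)
      (fun _ _ => Nat.zero_le _) hy'
    omega

/-- A nearly complete relation has alternating cycles of all lengths. -/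
theorem IsNearlyComplete.hasAlternatingCycle_of_le {R : α → β → Prop} {A : Finset α}
    {B : Finset β} {m k : ℕ} (h : IsNearlyComplete R A B m) (hk : k ≤ m) :
    HasAlternatingCycle R A B k := by
  induction m generalizing A B with
  | zero =>
    obtain rfl := Nat.le_zero.1 hk
    exact h.hasAlternatingCycle
  | succ m ih =>
    rcases Nat.le_succ_iff.1 hk with hk | rfl
    · obtain ⟨A', hA, B', hB, h'⟩ := h.exists_erase
      exact (ih h' hk).mono hA hB
    · exact h.hasAlternatingCycle

end AlternatingCycle

/-! ### From alternating cycles to graph cycles, and the spectral bound. -/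

namespace SimpleGraph

variable {V : Type*}

/-- An alternating cycle of the adjacency relation between disjoint sets is a cycle. -/
theorem hasCycleOfLength_of_hasAlternatingCycle {G : SimpleGraph V} {A B : Finset V} {m : ℕ}
    (hAB : Disjoint A B) (h : HasAlternatingCycle G.Adj A B m) :
    G.HasCycleOfLength (2 * (m + 2)) := by
  obtain ⟨a, b, ha, hb, haA, hbB, h₁, h₂⟩ := h
  have hne : ∀ i j, a i ≠ b j := fun i j hij => Finset.disjoint_left.1 hAB (haA i) (hij ▸ hbB j)
  let q : Fin (2 * m + 2 + 2) → Fin (m + 2) := fun i => ⟨i / 2, by omega⟩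
  -- Interleaving: even positions carry the `a`'s, odd positions the `b`'s.
  let f : Fin (2 * m + 2 + 2) → V := fun i => if (i : ℕ) % 2 = 0 then a (q i) else b (q i)
  have hf : Function.Injective f := by
    intro i j hij
    simp only [f] at hij
    ext
    split_ifs at hij with hi hj hj
    · have := congrArg Fin.val (ha hij)
      simp only [q] at this
      omega
    · exact absurd hij (hne _ _)
    · exact absurd hij.symm (hne _ _)
    · have := congrArg Fin.val (hb hij)
      simp only [q] at this
      omega
  have hstep : ∀ i, G.Adj (f i) (f (i + 1)) := by
    intro i
    by_cases hi : i = Fin.last _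
    · have e1 : i + 1 = 0 := by rw [hi, Fin.last_add_one]
      have hv : (i : ℕ) = 2 * m + 3 := by rw [hi]; simp
      have e2 : q i = Fin.last _ := by ext; simp only [q, hv, Fin.val_last]; omega
      have e3 : ¬ (i : ℕ) % 2 = 0 := by omega
      have e4 : q 0 = 0 := by ext; simp [q]
      have := h₂ (Fin.last _)
      rw [Fin.last_add_one] at this
      rw [e1]
      simp only [f, if_neg e3, e2, Fin.val_zero, Nat.zero_mod, if_true, e4]
      exact this.symm
    · have hv : ((i + 1 : Fin (2 * m + 2 + 2)) : ℕ) = i + 1 :=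
        Fin.val_add_one_of_lt (Fin.lt_last_iff_ne_last.2 hi)
      by_cases hp : (i : ℕ) % 2 = 0
      · have e1 : ¬ ((i + 1 : Fin (2 * m + 2 + 2)) : ℕ) % 2 = 0 := by omega
        have e2 : q (i + 1) = q i := by ext; simp only [q, hv]; omega
        simp only [f, if_pos hp, if_neg e1, e2]
        exact h₁ _
      · have e1 : ((i + 1 : Fin (2 * m + 2 + 2)) : ℕ) % 2 = 0 := by omega
        have hlt : (i : ℕ) < 2 * m + 3 := Fin.lt_last_iff_ne_last.2 hi
        have e3 : q i < Fin.last _ := by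
          rw [Fin.lt_def]; simp only [q, Fin.val_last]; omega
        have e2 : q (i + 1) = q i + 1 := by
          ext
          rw [Fin.val_add_one_of_lt e3]
          simp only [q, hv]; omega
        simp only [f, if_neg hp, if_pos e1, e2]
        exact (h₂ _).symm
  have hcont : (cycleGraph (2 * m + 2 + 2)).IsContained G := by
    refine ⟨⟨⟨f, ?_⟩, hf⟩⟩
    intro i j hij
    rw [cycleGraph_adj] at hij
    rcases hij with hij | hij
    · rw [sub_eq_iff_eq_add.1 hij, add_comm]
      exact (hstep j).symm
    · rw [sub_eq_iff_eq_add.1 hij, add_comm]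
      exact hstep i
  obtain ⟨v, p, hp, hlen⟩ := (cycleGraph_isContained_iff (by omega)).1 hcont
  exact ⟨v, p, hp, by omega⟩

/-- The adjacency matrix has an eigenvector for the largest eigenvalue. -/
theorem exists_eigenvector_maxAdjEigenvalue [Fintype V] [DecidableEq V] [Nonempty V]
    (G : SimpleGraph V) [DecidableRel G.Adj] :
    ∃ f : V → ℝ, f ≠ 0 ∧ (G.adjMatrix ℝ).mulVec f = G.maxAdjEigenvalue • f := by
  let e : Fin (Fintype.card V) ≃ V := Fintype.equivOfCardEq (Fintype.card_fin _)
  have h := G.isHermitian_adjMatrix_real.mulVec_eigenvectorBasis (e ⟨0, Fintype.card_pos⟩)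
  have h1 : G.isHermitian_adjMatrix_real.eigenvalues (e ⟨0, Fintype.card_pos⟩)
      = G.maxAdjEigenvalue := by
    simp [Matrix.IsHermitian.eigenvalues, e, maxAdjEigenvalue, adjEigenvalues]
  rw [h1] at h
  refine ⟨_, ?_, h⟩
  intro h0
  have h2 := (G.isHermitian_adjMatrix_real.eigenvectorBasis).orthonormal.ne_zero
    (e ⟨0, Fintype.card_pos⟩)
  exact h2 (by ext i; exact congrFun h0 i)

/-- If a nonzero adjacency eigenvalue of a bipartite graph without isolated vertices has square at
least the number of edges, then the graph is complete bipartite. -/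
theorem adj_of_card_le_eigenvalue_sq [Fintype V] [DecidableEq V] {G : SimpleGraph V}
    [DecidableRel G.Adj] {X Y : Finset V} (hG : G.IsBipartiteWith (X : Set V) (Y : Set V))
    (hXY : X ∪ Y = Finset.univ) (hdeg : ∀ v, ∃ w, G.Adj v w) {f : V → ℝ} (hf : f ≠ 0) {μ : ℝ}
    (hμ : 0 < μ) (hfμ : (G.adjMatrix ℝ).mulVec f = μ • f)
    (hle : ∑ x ∈ X, ∑ y ∈ Y, (if G.Adj x y then (1 : ℝ) else 0) ≤ μ ^ 2) :
    ∀ x ∈ X, ∀ y ∈ Y, G.Adj x y := by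
  have hdisj : Disjoint X Y := Finset.disjoint_coe.1 hG.disjoint
  have hv : ∀ v, ∑ w, (if G.Adj v w then f w else 0) = μ * f v := by
    intro v
    have := congrFun hfμ v
    simp only [Matrix.mulVec, dotProduct, adjMatrix_apply, ite_mul, one_mul, zero_mul,
      Pi.smul_apply, smul_eq_mul] at this
    exact this
  have hsplit : ∀ g : V → ℝ, ∑ w, g w = ∑ w ∈ X, g w + ∑ w ∈ Y, g w := fun g => by
    rw [← hXY, Finset.sum_union hdisj]
  have hX : ∀ x ∈ X, ∑ y ∈ Y, (if G.Adj x y then f y else 0) = μ * f x := by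
    intro x hx
    rw [← hv x, hsplit, Finset.sum_eq_zero (s := X), zero_add]
    intro w hw
    rw [if_neg]
    intro h
    exact Finset.disjoint_left.1 hdisj hw (Finset.mem_coe.1 (hG.mem_of_mem_adj hx h))
  have hY : ∀ y ∈ Y, ∑ x ∈ X, (if G.Adj x y then f x else 0) = μ * f y := by
    intro y hy
    rw [← hv y, hsplit, Finset.sum_eq_zero (s := Y), add_zero]
    · simp only [G.adj_comm]
    intro w hw
    rw [if_neg]
    intro h
    exact Finset.disjoint_left.1 hdisj (Finset.mem_coe.1 (hG.symm.mem_of_mem_adj hy h)) hw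
  set t := ∑ x ∈ X, f x ^ 2 with ht
  set S := ∑ x ∈ X, ∑ y ∈ Y, (if G.Adj x y then f x * f y else 0) with hS
  have hS1 : S = μ * t := by
    rw [hS, ht, Finset.mul_sum]
    refine Finset.sum_congr rfl fun x hx => ?_
    rw [sq, ← mul_assoc, ← hX x hx, Finset.sum_mul]
    refine Finset.sum_congr rfl fun y _ => ?_
    split_ifs <;> ring
  have hS2 : S = μ * ∑ y ∈ Y, f y ^ 2 := by
    rw [hS, Finset.sum_comm, Finset.mul_sum]
    refine Finset.sum_congr rfl fun x hx => ?_
    rw [sq, ← mul_assoc, ← hY x hx, Finset.sum_mul]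
    refine Finset.sum_congr rfl fun y _ => ?_
    split_ifs <;> ring
  have htY : ∑ y ∈ Y, f y ^ 2 = t := mul_left_cancel₀ hμ.ne' (hS2.symm.trans hS1)
  have htpos : 0 < t := by
    have h0 : 0 ≤ t := Finset.sum_nonneg fun _ _ => sq_nonneg _
    rcases h0.lt_or_eq with h | h
    · exact h
    · exfalso
      apply hf
      have h2 : ∑ v, f v ^ 2 = 0 := by rw [hsplit, htY, ← ht, ← h, add_zero]
      rw [Finset.sum_eq_zero_iff_of_nonneg fun _ _ => sq_nonneg _] at h2
      ext v
      simpa using h2 v (Finset.mem_univ v)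
  set M := ∑ x ∈ X, ∑ y ∈ Y, (if G.Adj x y then (1 : ℝ) else 0) with hM
  -- Compare the rank-one matrix `f x * f y` with `c` times the biadjacency matrix. Since `S = μ t`,
  -- this `c` makes the squared distance `t² (M / μ² - 1) ≤ 0`, so the two matrices agree.
  set c := t / μ with hc
  have hcpos : 0 < c := div_pos htpos hμ
  have hexp : ∑ x ∈ X, ∑ y ∈ Y, (f x * f y - (if G.Adj x y then c else 0)) ^ 2 =
      t * t - 2 * c * S + c ^ 2 * M := by
    have e1 : t * t = ∑ x ∈ X, ∑ y ∈ Y, f x ^ 2 * f y ^ 2 := by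
      rw [← Finset.sum_mul_sum, htY]
    rw [e1, hS, hM]
    simp only [Finset.mul_sum, ← Finset.sum_add_distrib, ← Finset.sum_sub_distrib]
    refine Finset.sum_congr rfl fun x _ => Finset.sum_congr rfl fun y _ => ?_
    split_ifs <;> ring
  have hnonpos : t * t - 2 * c * S + c ^ 2 * M ≤ 0 := by
    have hcμ : c * μ = t := div_mul_cancel₀ _ hμ.ne'
    have e1 : 2 * c * S = 2 * (t * t) := by rw [hS1, ← hcμ]; ring
    have e2 : c ^ 2 * M ≤ c ^ 2 * μ ^ 2 := mul_le_mul_of_nonneg_left hle (sq_nonneg c)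
    have e3 : c ^ 2 * μ ^ 2 = t * t := by rw [← hcμ]; ring
    linarith
  have hzero : ∀ x ∈ X, ∀ y ∈ Y, f x * f y = if G.Adj x y then c else 0 := by
    intro x hx y hy
    have h0 := le_antisymm (hexp.trans_le hnonpos)
      (Finset.sum_nonneg fun x _ => Finset.sum_nonneg fun y _ => sq_nonneg _)
    have h1 := (Finset.sum_eq_zero_iff_of_nonneg
      fun x _ => Finset.sum_nonneg fun y _ => sq_nonneg _).1 h0 x hx
    have h2 := (Finset.sum_eq_zero_iff_of_nonneg fun y _ => sq_nonneg _).1 h1 y hy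
    exact sub_eq_zero.1 (pow_eq_zero_iff two_ne_zero |>.1 h2)
  have hne : ∀ x ∈ X, ∀ y ∈ Y, G.Adj x y → f x ≠ 0 ∧ f y ≠ 0 := by
    intro x hx y hy h
    have := hzero x hx y hy
    rw [if_pos h] at this
    exact mul_ne_zero_iff.1 (this ▸ hcpos.ne')
  intro x hx y hy
  by_contra hxy
  -- Having a neighbour forces `f x` and `f y` to be nonzero, while non-adjacency would make their
  -- product vanish.
  obtain ⟨y', hy'⟩ := hdeg x
  obtain ⟨x', hx'⟩ := hdeg y
  have h1 := (hne x hx y' (hG.mem_of_mem_adj hx hy') hy').1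
  have h2 := (hne x' (hG.symm.mem_of_mem_adj hy hx') y hy hx'.symm).2
  have h3 := hzero x hx y hy
  rw [if_neg hxy] at h3
  exact mul_ne_zero h1 h2 h3

end SimpleGraph

/-! ### The main theorem. -/

open SimpleGraph in
theorem theorem1 {V : Type*} [Fintype V] [DecidableEq V] [Nonempty V]
    (G : SimpleGraph V) [DecidableRel G.Adj] (X Y : Finset V) (n : ℕ) (hn : 4 ≤ n)
    (hconn : G.Connected) (hbal : G.IsBalancedBipartiteWith X Y)
    (hcard : Fintype.card V = 2 * n) (hdeg : 2 ≤ G.minDegree)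
    (hspec : Real.sqrt ((n : ℝ) ^ 2 - 2 * (n : ℝ) + 4) ≤ G.maxAdjEigenvalue) :
    G.IsBipancyclic := by
  classical
  obtain ⟨hG, hXY, hXYc⟩ := hbal
  have hdisj : Disjoint X Y := Finset.disjoint_coe.1 hG.disjoint
  have hXc : X.card = n := by
    have h := Finset.card_union_of_disjoint hdisj
    rw [hXY, Finset.card_univ] at h
    omega
  have hYc : Y.card = n := hXYc ▸ hXc
  have hdeg' : ∀ v, 2 ≤ G.degree v := fun v => hdeg.trans (G.minDegree_le_degree v)
  have hnX : ∀ x ∈ X, (Y.filter fun y => ¬ G.Adj x y).card ≤ n - 2 := by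
    intro x hx
    have h1 := Finset.card_filter_add_card_filter_not (s := Y) (fun y => G.Adj x y)
    have h2 : G.degree x ≤ (Y.filter fun y => G.Adj x y).card := by
      rw [← card_neighborFinset_eq_degree]
      refine Finset.card_le_card fun y hy => ?_
      rw [mem_neighborFinset] at hy
      exact Finset.mem_filter.2 ⟨hG.mem_of_mem_adj hx hy, hy⟩
    have := hdeg' x
    omega
  have hnY : ∀ y ∈ Y, (X.filter fun x => ¬ G.Adj x y).card ≤ n - 2 := by
    intro y hy
    have h1 := Finset.card_filter_add_card_filter_not (s := X) (fun x => G.Adj x y)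
    have h2 : G.degree y ≤ (X.filter fun x => G.Adj x y).card := by
      rw [← card_neighborFinset_eq_degree]
      refine Finset.card_le_card fun x hx => ?_
      rw [mem_neighborFinset] at hx
      exact Finset.mem_filter.2 ⟨hG.symm.mem_of_mem_adj hy hx, hx.symm⟩
    have := hdeg' y
    omega
  have hsum : ∑ x ∈ X, (Y.filter fun y => ¬ G.Adj x y).card ≤ 2 * (n - 2) - 1 := by
    obtain ⟨f, hf, hfμ⟩ := G.exists_eigenvector_maxAdjEigenvalue
    have hn' : (4 : ℝ) ≤ n := by exact_mod_cast hn
    have hpos : (0 : ℝ) < (n : ℝ) ^ 2 - 2 * (n : ℝ) + 4 := by nlinarith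
    have hμ : 0 < G.maxAdjEigenvalue := (Real.sqrt_pos.2 hpos).trans_le hspec
    have hsq : (n : ℝ) ^ 2 - 2 * (n : ℝ) + 4 ≤ G.maxAdjEigenvalue ^ 2 :=
      (Real.sqrt_le_left hμ.le).1 hspec
    -- Either the edge count is at most λ₁², which forces completeness, or it strictly exceeds λ₁².
    rcases le_or_gt (∑ x ∈ X, ∑ y ∈ Y, (if G.Adj x y then (1 : ℝ) else 0))
      (G.maxAdjEigenvalue ^ 2) with hle | hlt
    · have hall := adj_of_card_le_eigenvalue_sq hG hXY (fun v => by
        obtain ⟨w, hw⟩ := Finset.card_pos.1 (by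
          rw [card_neighborFinset_eq_degree]; have := hdeg' v; omega : 0 < (G.neighborFinset v).card)
        exact ⟨w, by simpa using hw⟩) hf hμ hfμ hle
      rw [Finset.sum_eq_zero]
      · exact Nat.zero_le _
      · intro x hx
        rw [Finset.card_eq_zero, Finset.filter_eq_empty_iff]
        exact fun y hy => not_not.2 (hall x hx y hy)
    · have h1 : ∑ x ∈ X, (Y.filter fun y => G.Adj x y).card +
          ∑ x ∈ X, (Y.filter fun y => ¬ G.Adj x y).card = n * n := by
        rw [← Finset.sum_add_distrib, Finset.sum_congr rfl fun x _ =>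
          Finset.card_filter_add_card_filter_not (s := Y) (fun y => G.Adj x y)]
        rw [Finset.sum_const, hXc, hYc, smul_eq_mul]
      have h2 : ∑ x ∈ X, ∑ y ∈ Y, (if G.Adj x y then (1 : ℝ) else 0) =
          ((∑ x ∈ X, (Y.filter fun y => G.Adj x y).card : ℕ) : ℝ) := by
        push_cast
        refine Finset.sum_congr rfl fun x _ => ?_
        rw [Finset.sum_boole]
      rw [h2] at hlt
      -- The strictness matters: fewer than `2n - 4` missing pairs means at most `2 (n - 2) - 1`,
      -- exactly the bound in `IsNearlyComplete`.
      have h3 : n ^ 2 + 4 < (∑ x ∈ X, (Y.filter fun y => G.Adj x y).card) + 2 * n := by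
        have : (n : ℝ) ^ 2 + 4 <
          ((∑ x ∈ X, (Y.filter fun y => G.Adj x y).card : ℕ) : ℝ) + 2 * n := by linarith
        exact_mod_cast this
      rw [sq] at h3
      omega
  obtain ⟨m, rfl⟩ := Nat.exists_eq_add_of_le' (show 2 ≤ n by omega)
  rw [Nat.add_sub_cancel] at hsum hnX hnY
  have hnear : IsNearlyComplete G.Adj X Y m := by
    refine ⟨hXc, hYc, ?_, ?_, ?_⟩
    · convert hsum
    · intro x hx
      convert hnX x hx
    · intro y hy
      convert hnY y hy
  intro k hk hk4 hkn
  obtain ⟨j, rfl⟩ := hk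
  obtain ⟨i, rfl⟩ := Nat.exists_eq_add_of_le' (show 2 ≤ j by omega)
  rw [← two_mul]
  exact hasCycleOfLength_of_hasAlternatingCycle hdisj
    (hnear.hasAlternatingCycle_of_le (by omega))
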